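/- Let $\mathbf{Top}$ be the category of topological spaces and continuous maps. All subcategories are full and isomorphism-closed, and each is assumed to contain at least one space with at least two points. A subcategory $\mathbf{A}$ of $\mathbf{Top}$ is epireflective if every space has a reflection in $\mathbf{A}$ and all reflection arrows are epimorphisms in $\mathbf{Top}$; a subcategory $\mathbf{C}$ of $\mathbf{Top}$ is coreflective if every space has a coreflection in $\mathbf{C}$. A subcategory is hereditary if it is closed under the formation of subspaces. A subcategory $\mathbf{B}\subseteq\mathbf{A}$ is an HAD-class in $\mathbf{A}$ if it is hereditary, closed under topological sums, and divisible in $\mathbf{A}$, i.e. for every quotient map $q\colon X\to Y$ with $X\in\mathbf{B}$ and $Y\in\mathbf{A}$ we have $Y\in\mathbf{B}$. Let $\mathbf{FG}$ be the class of finitely generated spaces, i.e. spaces in which every intersection of open sets is open. Let $\mathbf{A}$ be an epireflective subcategory of $\mathbf{Top}$ all of whose members are Hausdorff spaces. Then the assignment $\mathbf{C}\mapsto\mathbf{C}\cap\mathbf{A}$ is a bijection from the hereditary coreflective subcategories $\mathbf{C}$ of $\mathbf{Top}$ with $\mathbf{C}\supseteq\mathbf{FG}$ onto the HAD-classes in $\mathbf{A}$.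 -/

import Mathlib

open CategoryTheory

universe u

/-- A full, isomorphism-closed subcategory of `Top`, given by the property of being one of its
objects; by convention it contains a space with at least two points. -/
structure IsSubcategoryOfTop (P : ObjectProperty TopCat.{u}) : Prop where
  isoClosed : P.IsClosedUnderIsomorphisms
  exists_nontrivial : ∃ X : TopCat.{u}, P X ∧ Nontrivial X

/-- The morphism `r : X ⟶ R` is a reflection arrow of `X` in the full subcategory `P`. -/
structure IsReflectionArrow (P : ObjectProperty TopCat.{u}) {X R : TopCat.{u}} (r : X ⟶ R) :
    Prop where
  mem : P R
  existsUnique_fac : ∀ (A : TopCat.{u}), P A → ∀ f : X ⟶ A, ∃! g : R ⟶ A, r ≫ g = f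

/-- The morphism `c : K ⟶ X` is a coreflection arrow of `X` in the full subcategory `P`. -/
structure IsCoreflectionArrow (P : ObjectProperty TopCat.{u}) {K X : TopCat.{u}} (c : K ⟶ X) :
    Prop where
  mem : P K
  existsUnique_fac : ∀ (A : TopCat.{u}), P A → ∀ f : A ⟶ X, ∃! g : A ⟶ K, g ≫ c = f

/-- An epireflective subcategory of `Top`: every space has a reflection, and all reflection
arrows are epimorphisms in `Top`. -/
structure IsEpireflective (P : ObjectProperty TopCat.{u}) : Prop where
  isSubcategory : IsSubcategoryOfTop P
  exists_reflection : ∀ X : TopCat.{u}, ∃ (R : TopCat.{u}) (r : X ⟶ R), IsReflectionArrow P r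
  epi_reflection : ∀ (X R : TopCat.{u}) (r : X ⟶ R), IsReflectionArrow P r → Epi r

/-- A coreflective subcategory of `Top`: every space has a coreflection. -/
structure IsCoreflective (P : ObjectProperty TopCat.{u}) : Prop where
  isSubcategory : IsSubcategoryOfTop P
  exists_coreflection :
    ∀ X : TopCat.{u}, ∃ (K : TopCat.{u}) (c : K ⟶ X), IsCoreflectionArrow P c

/-- Closed under topological subspaces. -/
def IsHereditaryClass (P : ObjectProperty TopCat.{u}) : Prop :=
  ∀ X : TopCat.{u}, P X → ∀ s : Set X, P (TopCat.of s)

/-- Closed under topological sums. -/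
def IsAdditiveClass (P : ObjectProperty TopCat.{u}) : Prop :=
  ∀ (ι : Type u) (X : ι → TopCat.{u}), (∀ i, P (X i)) → P (TopCat.of (Σ i, X i))

/-- `B` is divisible in `A`: closed under those quotient spaces that belong to `A`. -/
def IsDivisibleIn (A B : ObjectProperty TopCat.{u}) : Prop :=
  ∀ (X Y : TopCat.{u}) (q : X ⟶ Y), Topology.IsQuotientMap q → B X → A Y → B Y

/-- `B` is an HAD-class in `A`: a subcategory of `A` that is hereditary, additive, and divisible
in `A`. -/
structure IsHADClass (A B : ObjectProperty TopCat.{u}) : Prop where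
  isSubcategory : IsSubcategoryOfTop B
  le : B ≤ A
  hereditary : IsHereditaryClass B
  additive : IsAdditiveClass B
  divisible : IsDivisibleIn A B

/-- The class of finitely generated spaces: any intersection of open sets is open. -/
def FinitelyGeneratedSpaces : ObjectProperty TopCat.{u} := fun X => AlexandrovDiscrete X

/-! ### Topologies generated by filters, and prime spaces -/

open Filter Set Topology

/-! A topology is recovered from the prime spaces of its neighbourhood filters, and the class `A`
contains the prime space of every free filter (`IsEpireflective.primeSpace_mem`). The inverse
assignment therefore sends `B` to `primeClass B`: each neighbourhood filter splits into a principal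
part, which `FG` takes care of, and a free part, whose prime space is required to lie in `B`.

Two points are hard. A member of `B` must have its prime factors in `B`, although making all points
but one isolated is not a quotient construction. Hanging a nontrivial prime space at every point
supplies isolated points that can be collapsed instead (`IsHADClass.primeSpace_nhds_inf_mem`).

Coreflectivity of `primeClass B` needs that topologies generated by admissible filters have
admissible neighbourhood filters. A tree in `B`, mapped openly, reduces this to the previous point
(`primeClass_filterSpace`).

Injectivity comes from `IsCoreflective.eq_primeClass_inf`, surjectivity from `primeClass_inf_eq`. -/

/-- The topology in which `U` is open iff it belongs to `H x` for each of its points `x`. -/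
abbrev filterTopology {X : Type u} (H : X → Filter X) : TopologicalSpace X where
  IsOpen U := ∀ x ∈ U, U ∈ H x
  isOpen_univ _ _ := univ_mem
  isOpen_inter _ _ hU hV x hx := inter_mem (hU x hx.1) (hV x hx.2)
  isOpen_sUnion _ hS x hx :=
    let ⟨U, hU, hxU⟩ := hx
    mem_of_superset (hS U hU x hxU) (subset_sUnion_of_mem hU)

/-- The space with the topology generated by the filters `H x`. -/
def filterSpace {X : Type u} (H : X → Filter X) : TopCat.{u} :=
  @TopCat.of X (filterTopology H)

lemma isOpen_filterSpace {X : Type u} {H : X → Filter X} {U : Set (filterSpace H)} :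
    IsOpen U ↔ ∀ x ∈ U, U ∈ H x := Iff.rfl

/-- The filter system of `primeSpace`. -/
def primeFilters {α : Type u} (G : Filter α) : Option α → Filter (Option α)
  | none => G.map some
  | some _ => ⊥

/-- The space `α ∪ {none}` in which all points of `α` are isolated and the punctured
neighbourhoods of `none` are given by `G`. -/
abbrev primeSpace {α : Type u} (G : Filter α) : TopCat.{u} := filterSpace (primeFilters G)

lemma isOpen_primeSpace {α : Type u} {G : Filter α} {U : Set (primeSpace G)} :
    IsOpen U ↔ ((none : Option α) ∈ U → some ⁻¹' U ∈ G) := by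
  rw [isOpen_filterSpace]
  constructor
  · exact fun h hn => h _ hn
  · rintro h (_ | x) hx
    · exact h hx
    · exact mem_bot

lemma discreteTopology_primeSpace_bot {α : Type u} :
    DiscreteTopology (primeSpace (⊥ : Filter α)) :=
  discreteTopology_iff_forall_isOpen.2 fun _ => isOpen_primeSpace.2 fun _ => mem_bot

lemma compl_singleton_mem_of_ker_eq_empty {T : Type u} {F : Filter T} (hF : F.ker = ∅) (t : T) :
    {t}ᶜ ∈ F := by
  have ht : t ∉ F.ker := by simp [hF]
  simp only [mem_ker, not_forall] at ht
  obtain ⟨s, hs, hts⟩ := ht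
  exact mem_of_superset hs fun y hy hyt => hts (by simpa [← show y = t from hyt] using hy)

lemma ker_eq_empty_iff_compl_singleton_mem {T : Type u} {F : Filter T} :
    F.ker = ∅ ↔ ∀ t, {t}ᶜ ∈ F :=
  ⟨compl_singleton_mem_of_ker_eq_empty, fun h => eq_empty_of_forall_notMem fun t ht =>
    mem_ker.1 ht _ (h t) rfl⟩

/-! ### Epireflective subcategories of Hausdorff spaces -/

section Epireflective

variable {A : ObjectProperty TopCat.{u}}

/-- The reflection arrow is a homeomorphism. Epimorphisms in `Top` are surjective. The test maps,
and the clopen sets viewed as two-valued maps into `Z₀`, factor through the arrow, so it is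
inducing, hence injective on a T0 space. -/
lemma IsEpireflective.mem_of_test (hA : IsEpireflective A)
    (hHaus : ∀ X : TopCat.{u}, A X → T2Space X)
    (Y : TopCat.{u}) [T0Space Y]
    (h : ∀ (x : Y) (U : Set Y), IsOpen U → x ∈ U → ∃ (Z : TopCat.{u}) (f : Y ⟶ Z) (V : Set Z)
      (K : Set Y), A Z ∧ IsOpen V ∧ IsClopen K ∧ x ∈ f ⁻¹' V ∩ K ∧ f ⁻¹' V ∩ K ⊆ U) : A Y := by
  obtain ⟨R, r, hr⟩ := hA.exists_reflection Y
  obtain ⟨Z₀, hZ₀, p, q, hpq⟩ := hA.isSubcategory.exists_nontrivial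
  have := hHaus _ hZ₀
  have := hA.isSubcategory.isoClosed
  have hsurj : Function.Surjective r :=
    (TopCat.epi_iff_surjective r).1 (hA.epi_reflection _ _ r hr)
  have hind : IsInducing r := by
    rw [isInducing_iff_nhds]
    refine fun x => le_antisymm (map_le_iff_le_comap.1 r.hom.continuous.continuousAt) ?_
    intro S hS
    obtain ⟨U, hUS, hU, hxU⟩ := mem_nhds_iff.1 hS
    obtain ⟨Z, f, V, K, hZ, hV, hK, hx, hsub⟩ := h x U hU hxU
    obtain ⟨g, hg, -⟩ := hr.existsUnique_fac Z hZ f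
    classical
    let k : Y ⟶ Z₀ := TopCat.ofHom ⟨fun y => if y ∈ K then p else q, by
      refine Continuous.if ?_ continuous_const continuous_const
      intro a ha
      have hf : frontier K = ∅ := hK.frontier_eq
      have ha' : a ∈ frontier K := ha
      simp [hf] at ha'⟩
    have hk (y : Y) : k y = if y ∈ K then p else q := rfl
    obtain ⟨l, hl, -⟩ := hr.existsUnique_fac Z₀ hZ₀ k
    have hgy (y : Y) : g (r y) = f y := by rw [← hg]; rfl
    have hly (y : Y) : l (r y) = k y := by rw [← hl]; rfl
    refine mem_comap.2 ⟨g ⁻¹' V ∩ l ⁻¹' {q}ᶜ, ?_, ?_⟩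
    · refine ((hV.preimage g.hom.continuous).inter
        (isOpen_compl_singleton.preimage l.hom.continuous)).mem_nhds ⟨?_, ?_⟩
      · change g (r x) ∈ V
        rw [hgy]; exact hx.1
      · change l (r x) ≠ q
        rw [hly, hk, if_pos hx.2]; exact hpq
    · rintro y ⟨hy1, hy2⟩
      change g (r y) ∈ V at hy1
      change l (r y) ≠ q at hy2
      rw [hgy] at hy1
      rw [hly, hk] at hy2
      refine hUS (hsub ⟨hy1, ?_⟩)
      by_contra hyK
      exact hy2 (if_neg hyK)
  exact ObjectProperty.prop_of_iso A (TopCat.isoOfHomeo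
    ((Equiv.ofBijective r ⟨hind.injective, hsurj⟩).toHomeomorphOfIsInducing hind)).symm hr.mem

lemma IsEpireflective.mem_of_clopen (hA : IsEpireflective A)
    (hHaus : ∀ X : TopCat.{u}, A X → T2Space X) (Y : TopCat.{u}) [T0Space Y]
    (h : ∀ (x : Y) (U : Set Y), IsOpen U → x ∈ U → ∃ K, IsClopen K ∧ x ∈ K ∧ K ⊆ U) : A Y := by
  obtain ⟨Z₀, hZ₀, p, -⟩ := hA.isSubcategory.exists_nontrivial
  refine hA.mem_of_test hHaus Y fun x U hU hx => ?_
  obtain ⟨K, hK, hxK, hKU⟩ := h x U hU hx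
  exact ⟨Z₀, TopCat.ofHom ⟨fun _ => p, continuous_const⟩, univ, K, hZ₀, isOpen_univ, hK,
    ⟨trivial, hxK⟩, fun y hy => hKU hy.2⟩

lemma IsEpireflective.hereditary (hA : IsEpireflective A)
    (hHaus : ∀ X : TopCat.{u}, A X → T2Space X) : IsHereditaryClass A := by
  intro X hX s
  have := hHaus X hX
  refine hA.mem_of_test hHaus (TopCat.of s) fun x U hU hx => ?_
  obtain ⟨V, hV, rfl⟩ := isOpen_induced_iff.1 hU
  exact ⟨X, TopCat.ofHom ⟨Subtype.val, continuous_subtype_val⟩, V, univ, hX, hV, isClopen_univ,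
    ⟨hx, trivial⟩, fun y hy => hy.1⟩

lemma IsEpireflective.additive (hA : IsEpireflective A)
    (hHaus : ∀ X : TopCat.{u}, A X → T2Space X) : IsAdditiveClass A := by
  intro ι X hX
  have := fun i => hHaus _ (hX i)
  refine hA.mem_of_test hHaus (TopCat.of (Σ i, X i)) fun x U hU hx => ?_
  obtain ⟨i, x⟩ := x
  classical
  -- A retraction onto the summand of the test point; the other summands go to that point and are
  -- discarded by the clopen range.
  let f : (Σ i, X i) → X i := fun z => if h : z.1 = i then h ▸ z.2 else x
  have hf (y : X i) : f ⟨i, y⟩ = y := by simp [f]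
  have hcont : Continuous f := by
    refine continuous_sigma fun j => ?_
    by_cases hj : j = i
    · subst hj
      exact continuous_id.congr fun y => (hf y).symm
    · exact continuous_const.congr fun y => (dif_neg hj).symm
  refine ⟨X i, TopCat.ofHom ⟨f, hcont⟩, (fun y => (⟨i, y⟩ : Σ i, X i)) ⁻¹' U,
    range (fun y => (⟨i, y⟩ : Σ i, X i)), hX i, isOpen_sigma_iff.1 hU i, isClopen_range_sigmaMk,
    ⟨?_, x, rfl⟩, ?_⟩
  · change (⟨i, f ⟨i, x⟩⟩ : Σ i, X i) ∈ U
    rwa [hf]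
  · rintro _ ⟨hy, y, rfl⟩
    change (⟨i, f ⟨i, y⟩⟩ : Σ i, X i) ∈ U at hy
    rwa [hf] at hy

lemma IsEpireflective.primeSpace_mem (hA : IsEpireflective A)
    (hHaus : ∀ X : TopCat.{u}, A X → T2Space X) {α : Type u} {G : Filter α} (hG : G.ker = ∅) :
    A (primeSpace G) := by
  have hfree := compl_singleton_mem_of_ker_eq_empty hG
  have hopen (x : α) : IsClopen (X := primeSpace G) {some x} := by
    constructor
    · rw [← isOpen_compl_iff, isOpen_primeSpace]
      intro _
      filter_upwards [hfree x] with y hy h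
      exact hy (Option.some_injective _ h)
    · exact isOpen_primeSpace.2 fun h => by cases h
  have : T0Space (primeSpace G) := by
    refine ⟨fun a b hab => ?_⟩
    rw [inseparable_iff_forall_isOpen] at hab
    rcases a with _ | a
    · rcases b with _ | b
      · rfl
      · exact (hab _ (hopen b).isOpen).2 rfl
    · exact ((hab _ (hopen a).isOpen).1 rfl).symm
  refine hA.mem_of_clopen hHaus _ fun x U hU hx => ?_
  rcases x with _ | x
  · refine ⟨U, ⟨?_, hU⟩, hx, subset_rfl⟩
    rw [← isOpen_compl_iff, isOpen_primeSpace]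
    exact fun h => (h hx).elim
  · exact ⟨_, hopen x, rfl, by rintro _ rfl; exact hx⟩

end Epireflective

/-! ### Coreflective subcategories containing the finitely generated spaces -/

section Coreflective

variable {C : ObjectProperty TopCat.{u}}

/-- The coreflection arrow is bijective, since `C` contains the one-point space, and open, since
every `f i` lifts through it. -/
lemma IsCoreflective.mem_of_final (hC : IsCoreflective C) (hFG : FinitelyGeneratedSpaces ≤ C)
    {Y : TopCat.{u}} {ι : Type u} (X : ι → TopCat.{u}) (hX : ∀ i, C (X i)) (f : ∀ i, X i → Y)
    (hf : ∀ U : Set Y, IsOpen U ↔ ∀ i, IsOpen (f i ⁻¹' U)) : C Y := by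
  obtain ⟨K, c, hc⟩ := hC.exists_coreflection Y
  have := hC.isSubcategory.isoClosed
  have hpt : C (TopCat.of PUnit.{u + 1}) := hFG _ (by
    change AlexandrovDiscrete PUnit
    infer_instance)
  have hinj : Function.Injective c := by
    intro x y hxy
    obtain ⟨g, -, hg⟩ := hc.existsUnique_fac _ hpt (TopCat.ofHom ⟨fun _ => c x, continuous_const⟩)
    have h1 := hg (TopCat.ofHom ⟨fun _ => x, continuous_const⟩) rfl
    have h2 := hg (TopCat.ofHom ⟨fun _ => y, continuous_const⟩) (by
      ext; exact hxy.symm)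
    exact congrArg (fun k : TopCat.of PUnit.{u + 1} ⟶ K => k PUnit.unit) (h1.trans h2.symm)
  have hsurj : Function.Surjective c := by
    intro y
    obtain ⟨g, hg, -⟩ := hc.existsUnique_fac _ hpt (TopCat.ofHom ⟨fun _ => y, continuous_const⟩)
    exact ⟨g PUnit.unit, congrArg (fun k : TopCat.of PUnit.{u + 1} ⟶ Y => k PUnit.unit) hg⟩
  have hopen : IsOpenMap c := by
    intro U hU
    rw [hf]
    intro i
    obtain ⟨g, hg, -⟩ := hc.existsUnique_fac _ (hX i)
      (TopCat.ofHom ⟨f i, continuous_def.2 fun U hU => (hf U).1 hU i⟩)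
    have hgx (x : X i) : c (g x) = f i x :=
      congrArg (fun k : X i ⟶ Y => k x) hg
    convert hU.preimage g.hom.continuous using 1
    ext x
    change f i x ∈ c '' U ↔ g x ∈ U
    rw [← hgx, hinj.mem_set_image]
  exact ObjectProperty.prop_of_iso C (TopCat.isoOfHomeo
    ((Equiv.ofBijective c ⟨hinj, hsurj⟩).toHomeomorphOfContinuousOpen
      c.hom.continuous hopen)) hc.mem

/-- This makes the results on HAD-classes available for `C` itself, with all of `Top` as ambient
category. -/
lemma IsCoreflective.isHADClass_top (hC : IsCoreflective C) (hh : IsHereditaryClass C)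
    (hFG : FinitelyGeneratedSpaces ≤ C) : IsHADClass ⊤ C where
  isSubcategory := hC.isSubcategory
  le := le_top
  hereditary := hh
  additive ι X hX := hC.mem_of_final hFG X hX 
    (fun i x => (⟨i, x⟩ : Σ i, X i)) fun _ => isOpen_sigma_iff
  divisible X Y q hq hX _ := hC.mem_of_final hFG (ι := PUnit) (fun _ => X) (fun _ => hX)
    (fun _ => q) fun U => by simp [hq.isOpen_preimage]

lemma IsCoreflective.isHADClass_inf (hC : IsCoreflective C) (hh : IsHereditaryClass C)
    (hFG : FinitelyGeneratedSpaces ≤ C) {A : ObjectProperty TopCat.{u}} (hA : IsEpireflective A)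
    (hHaus : ∀ X : TopCat.{u}, A X → T2Space X) : IsHADClass A (C ⊓ A) where
  isSubcategory :=
    { isoClosed := ⟨fun e h => by
        have := hC.isSubcategory.isoClosed
        have := hA.isSubcategory.isoClosed
        exact ⟨C.prop_of_iso e h.1, A.prop_of_iso e h.2⟩⟩
      exists_nontrivial := by
        have : DiscreteTopology (primeSpace (⊥ : Filter PUnit.{u + 1})) :=
          discreteTopology_primeSpace_bot
        refine ⟨primeSpace (⊥ : Filter PUnit.{u + 1}), ⟨hFG _ ?_, hA.primeSpace_mem hHaus (by simp)⟩,
          none, some PUnit.unit, (Option.some_ne_none PUnit.unit).symm⟩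
        change AlexandrovDiscrete (primeSpace (⊥ : Filter PUnit.{u + 1}))
        infer_instance }
  le := inf_le_right
  hereditary X hX s := ⟨hh X hX.1 s, hA.hereditary hHaus X hX.2 s⟩
  additive ι X hX := ⟨(hC.isHADClass_top hh hFG).additive ι X fun i => (hX i).1,
    hA.additive hHaus ι X fun i => (hX i).2⟩
  divisible X Y q hq hX hY := ⟨(hC.isHADClass_top hh hFG).divisible X Y q hq hX.1 trivial, hY⟩

end Coreflective

/-! ### HAD-classes -/

namespace IsHADClass

variable {A B : ObjectProperty TopCat.{u}}

lemma discrete_mem (hB : IsHADClass A B) (X : TopCat.{u}) [DiscreteTopology X] : B X := by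
  obtain ⟨Z, hZ, p, -⟩ := hB.isSubcategory.exists_nontrivial
  have := hB.isSubcategory.isoClosed
  have hsum := hB.additive X (fun _ => TopCat.of ({p} : Set Z)) fun _ => hB.hereditary Z hZ {p}
  refine B.prop_of_iso (TopCat.isoOfHomeo (Homeomorph.symm ?_)) hsum
  refine ((Equiv.sigmaUnique X fun _ => ({p} : Set Z)).toHomeomorphOfContinuousOpen ?_ ?_).symm
  · exact continuous_sigma fun x => continuous_const
  · exact fun U _ => isOpen_discrete _

lemma mem_of_final (hB : IsHADClass A B) {Y : TopCat.{u}} (hY : A Y) {ι : Type u}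
    (X : ι → TopCat.{u}) (hX : ∀ i, B (X i)) (f : ∀ i, X i → Y)
    (hf : ∀ U : Set Y, IsOpen U ↔ ∀ i, IsOpen (f i ⁻¹' U)) : B Y := by
  -- A discrete copy of `Y` makes the sink jointly surjective without changing the final topology.
  let D : TopCat.{u} := filterSpace fun _ : Y => ⊥
  have : DiscreteTopology D := discreteTopology_iff_forall_isOpen.2 fun _ _ _ => mem_bot
  let X' : Option ι → TopCat.{u} := fun i => i.elim D X
  let f' : ∀ i, X' i → Y := fun i => match i with
    | none => id
    | some i => f i
  have hX' : ∀ i, B (X' i) := by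
    rintro (_ | i)
    · exact hB.discrete_mem D
    · exact hX i
  let q : (Σ i, X' i) → Y := fun z => f' z.1 z.2
  have hq : IsQuotientMap q := by
    refine (isQuotientMap_iff q).2
      ⟨isCoinducing_iff.2 fun U => ?_, fun y => ⟨⟨none, y⟩, rfl⟩⟩
    rw [isOpen_sigma_iff, hf]
    constructor
    · exact fun h i => h (some i)
    · rintro h (_ | i)
      · exact isOpen_discrete (α := D) _
      · exact h i
  exact hB.divisible (TopCat.of (Σ i, X' i)) Y (TopCat.ofHom ⟨q, hq.continuous⟩) hq
    (hB.additive _ X' hX') hY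

/-- A space whose topology is generated by filters with prime spaces in `B` belongs to `B`. -/
lemma mem_of_primeSpace (hB : IsHADClass A B) {Y : TopCat.{u}} (hY : A Y) (H : Y → Filter Y)
    (hH : ∀ y, B (primeSpace (H y))) (hU : ∀ U : Set Y, IsOpen U ↔ ∀ y ∈ U, U ∈ H y) : B Y := by
  refine hB.mem_of_final hY (fun y => primeSpace (H y)) hH
    (fun y => ((fun o => o.elim y id : Option Y → Y))) fun U => ?_
  rw [hU]
  exact forall_congr' fun y => (isOpen_primeSpace (G := H y)
    (U := (fun o => o.elim y id : Option Y → Y) ⁻¹' U)).symm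

lemma primeSpace_map_mem (hB : IsHADClass A B) {α β : Type u} {G : Filter α} (g : α → β)
    (hA : A (primeSpace (G.map g))) (hG : B (primeSpace G)) : B (primeSpace (G.map g)) := by
  refine hB.mem_of_final hA (ι := PUnit) (fun _ => primeSpace G) (fun _ => hG)
    (fun _ => (Option.map g : Option α → Option β)) fun U => ?_
  rw [forall_const, isOpen_primeSpace]
  exact (isOpen_primeSpace (G := G) (U := (Option.map g : Option α → Option β) ⁻¹' U)).symm

lemma primeSpace_sSup_mem (hB : IsHADClass A B)
    {α : Type u} {S : Set (Filter α)}
    (hA : A (primeSpace (sSup S))) (hS : ∀ G ∈ S, B (primeSpace G)) :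
    B (primeSpace (sSup S)) := by
  refine hB.mem_of_final hA (ι := S) (fun G => primeSpace G.1) (fun G => hS _ G.2)
    (fun _ => (id : Option α → Option α)) fun U => ?_
  rw [isOpen_primeSpace]
  refine Iff.trans ?_ (forall_congr' fun _ => isOpen_primeSpace.symm)
  constructor
  · exact fun h G hn => mem_sSup.1 (h hn) _ G.2
  · exact fun h hn => mem_sSup.2 fun G hG => h ⟨G, hG⟩ hn

/-- If the traces on `D` of the fibres of `l` are open, then the quotient of `D ∪ {t}` by the
fibres of `l` is a prime space. -/
lemma primeSpace_map_nhdsWithin_mem (hB : IsHADClass A B) {X : TopCat.{u}} (hX : B X) {t : X}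
    {D : Set X} (ht : t ∉ D) {T : Type u} (l : X → T) (hl : ∀ v, IsOpen (D ∩ l ⁻¹' {v}))
    (hA : A (primeSpace ((𝓝[D] t).map l))) : B (primeSpace ((𝓝[D] t).map l)) := by
  classical
  refine hB.mem_of_final hA (ι := PUnit) (fun _ => TopCat.of ↥(insert t D : Set X))
    (fun _ => hB.hereditary X hX _)
    (fun _ x => (if x.1 = t then none else some (l x.1) : Option T)) fun U => ?_
  rw [forall_const, isOpen_primeSpace]
  let f : ↥(insert t D : Set X) → Option T := fun x => if x.1 = t then none else some (l x.1)
  have hft (h : t ∈ (insert t D : Set X)) : f ⟨t, h⟩ = none := if_pos rfl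
  have hfD (x : X) (hx : x ∈ D) : f ⟨x, Or.inr hx⟩ = some (l x) :=
    if_neg fun h : x = t => ht (h ▸ hx)
  change _ ↔ IsOpen (f ⁻¹' U)
  rw [isOpen_iff_mem_nhds]
  constructor
  · rintro h ⟨x, rfl | hx⟩ hxU
    · change f _ ∈ U at hxU
      rw [hft (mem_insert _ _)] at hxU
      rw [nhds_subtype]
      obtain ⟨V, hV, hVU⟩ := mem_nhdsWithin_iff_exists_mem_nhds_inter.1 (h hxU)
      refine ⟨V, hV, ?_⟩
      rintro ⟨y, rfl | hy⟩ hyV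
      · change f _ ∈ U
        rwa [hft (mem_insert _ _)]
      · change f _ ∈ U
        rw [hfD y hy]
        exact hVU ⟨hyV, hy⟩
    · change f _ ∈ U at hxU
      rw [hfD x hx] at hxU
      rw [nhds_subtype]
      refine ⟨_, (hl (l x)).mem_nhds ⟨hx, rfl⟩, ?_⟩
      rintro ⟨y, hy'⟩ ⟨hy, hyx⟩
      change f _ ∈ U
      rw [hfD y hy, show l y = l x from hyx]
      exact hxU
  · intro h hn
    have h1 := h ⟨t, Or.inl rfl⟩ (by change f _ ∈ U; rwa [hft (mem_insert _ _)])
    rw [nhds_subtype] at h1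
    obtain ⟨V, hV, hVU⟩ := h1
    refine mem_nhdsWithin_iff_exists_mem_nhds_inter.2 ⟨V, hV, ?_⟩
    rintro x ⟨hxV, hxD⟩
    have h2 := @hVU ⟨x, Or.inr hxD⟩ hxV
    change f _ ∈ U at h2
    rw [hfD x hxD] at h2
    exact h2

lemma primeSpace_inf_principal_mem (hB : IsHADClass A B) {α : Type u} {G : Filter α} (s : Set α)
    (hA : A (primeSpace (G ⊓ 𝓟 s))) (hG : B (primeSpace G)) : B (primeSpace (G ⊓ 𝓟 s)) := by
  -- The subspace `{none} ∪ some '' s`. Its inclusion into the target is final because all points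
  -- outside it are isolated there.
  let S : Set (primeSpace G) := {x | ∀ a, (x : Option α) = some a → a ∈ s}
  refine hB.mem_of_final hA (ι := PUnit) (fun _ => TopCat.of S)
    (fun _ => hB.hereditary _ hG _) (fun _ x => x.1) fun U => ?_
  rw [forall_const, isOpen_primeSpace, mem_inf_principal]
  change _ ↔ IsOpen ((Subtype.val : S → primeSpace G) ⁻¹' U)
  rw [isOpen_induced_iff]
  constructor
  · intro h
    let W : Set (Option α) := {x | x ∈ U ∨ ∃ a, x = some a ∧ a ∉ s}
    refine ⟨W, isOpen_primeSpace.2 ?_, ?_⟩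
    · rintro (hn | ⟨a, ha, -⟩)
      · filter_upwards [h hn] with a ha
        by_cases has : a ∈ s
        · exact Or.inl (ha has)
        · exact Or.inr ⟨a, rfl, has⟩
      · cases ha
    · ext ⟨x, hx⟩
      constructor
      · rintro (hxU | ⟨a, rfl, ha⟩)
        · exact hxU
        · exact (ha (hx a rfl)).elim
      · exact Or.inl
  · rintro ⟨V, hV, hVU⟩ hn
    have hmem (x : Option α) (hx : ∀ a, x = some a → a ∈ s) : x ∈ V ↔ x ∈ U :=
      Set.ext_iff.1 hVU ⟨x, hx⟩
    have hnV := (hmem none (by rintro _ ⟨⟩)).2 hn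
    filter_upwards [isOpen_primeSpace.1 hV hnV] with a ha has
    exact (hmem (some a) (by rintro _ ⟨⟩; exact has)).1 ha

end IsHADClass

/-! ### Prime factors -/

/-- The filter system of `fanSpace`. -/
def fanFilters (X : TopCat.{u}) {T : Type u} (F : Filter T) : X ⊕ X × T → Filter (X ⊕ X × T)
  | .inl x => (𝓝 x).map .inl ⊔ F.map fun t => .inr (x, t)
  | .inr _ => ⊥

/-- The space `X` with a copy of `primeSpace F` attached at each of its points. -/
abbrev fanSpace (X : TopCat.{u}) {T : Type u} (F : Filter T) : TopCat.{u} :=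
  filterSpace (fanFilters X F)

lemma isOpen_fanSpace {X : TopCat.{u}} {T : Type u} {F : Filter T} {U : Set (fanSpace X F)} :
    IsOpen U ↔ IsOpen ((.inl : X → X ⊕ X × T) ⁻¹' U) ∧
      ∀ x : X, (.inl x : X ⊕ X × T) ∈ U → {t | (.inr (x, t) : X ⊕ X × T) ∈ U} ∈ F := by
  rw [isOpen_filterSpace]
  constructor
  · intro h
    exact ⟨isOpen_iff_mem_nhds.2 fun x hx => (mem_sup.1 (h (.inl x) hx)).1,
      fun x hx => (mem_sup.1 (h (.inl x) hx)).2⟩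
  · rintro ⟨h1, h2⟩ (x | x) hx
    · exact mem_sup.2 ⟨h1.mem_nhds hx, h2 x hx⟩
    · exact mem_bot

/-- The retraction of the fan space onto `X`. -/
def fanProj (X : TopCat.{u}) {T : Type u} (F : Filter T) (z : fanSpace X F) : X :=
  Sum.elim id Prod.fst (z : X ⊕ X × T)

lemma continuous_fanProj (X : TopCat.{u}) {T : Type u} (F : Filter T) :
    Continuous (fanProj X F) :=
  continuous_def.2 fun _ hU => isOpen_fanSpace.2 ⟨hU, fun _ hx => univ_mem' fun _ => hx⟩

lemma IsEpireflective.fanSpace_mem {A : ObjectProperty TopCat.{u}} (hA : IsEpireflective A)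
    (hHaus : ∀ X : TopCat.{u}, A X → T2Space X) {X : TopCat.{u}} (hX : A X) {T : Type u}
    {F : Filter T} (hF : F.ker = ∅) : A (fanSpace X F) := by
  have := hHaus X hX
  have hleaf (z : X × T) : IsClopen (X := fanSpace X F) {.inr z} := by
    constructor
    · rw [← isOpen_compl_iff, isOpen_fanSpace]
      refine ⟨?_, fun x _ => ?_⟩
      · convert isOpen_univ using 1
        exact eq_univ_of_forall fun x h => Sum.inl_ne_inr h
      · filter_upwards [compl_singleton_mem_of_ker_eq_empty hF z.2] with t ht h
        exact ht (congrArg Prod.snd (Sum.inr_injective h))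
    · rw [isOpen_fanSpace]
      refine ⟨?_, fun x h => (Sum.inl_ne_inr h).elim⟩
      convert isOpen_empty using 1
      exact eq_empty_of_forall_notMem fun x h => Sum.inl_ne_inr h
  have : T0Space (fanSpace X F) := by
    refine ⟨fun a b hab => ?_⟩
    have hab' := inseparable_iff_forall_isOpen.1 hab
    have hproj := (hab.map (continuous_fanProj X F)).eq
    rcases a with a | a
    · rcases b with b | b
      · exact congrArg Sum.inl (hproj : a = b)
      · exact (hab' _ (hleaf b).isOpen).2 rfl
    · exact ((hab' _ (hleaf a).isOpen).1 rfl).symm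
  refine hA.mem_of_test hHaus _ fun x U hU hx => ?_
  refine ⟨X, TopCat.ofHom (X := fanSpace X F) ⟨fanProj X F, continuous_fanProj X F⟩, ?_⟩
  rcases x with x | x
  · let K : Set (fanSpace X F) := {z | ∀ y : X × T, z = (.inr y : X ⊕ X × T) →
      (.inl y.1 : X ⊕ X × T) ∈ U → (.inr y : X ⊕ X × T) ∈ U}
    have hinl (x : X) : (.inl x : X ⊕ X × T) ∈ K := fun y h => (Sum.inl_ne_inr h).elim
    have hinr (y : X × T) : (.inr y : X ⊕ X × T) ∈ K ↔
        ((.inl y.1 : X ⊕ X × T) ∈ U → (.inr y : X ⊕ X × T) ∈ U) :=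
      ⟨fun h => h y rfl, fun h y' hy' => Sum.inr_injective hy' ▸ h⟩
    have hU' := isOpen_fanSpace.1 hU
    refine ⟨(.inl : X → X ⊕ X × T) ⁻¹' U, K, hX, hU'.1, ⟨?_, ?_⟩, ⟨hx, hinl x⟩, ?_⟩
    · rw [← isOpen_compl_iff, isOpen_fanSpace]
      refine ⟨?_, fun x h => (h (hinl x)).elim⟩
      convert isOpen_empty using 1
      exact eq_empty_of_forall_notMem fun x h => h (hinl x)
    · rw [isOpen_fanSpace]
      refine ⟨?_, fun x _ => ?_⟩
      · convert isOpen_univ using 1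
        exact eq_univ_of_forall hinl
      · by_cases hxU : (.inl x : X ⊕ X × T) ∈ U
        · filter_upwards [hU'.2 x hxU] with t ht
          exact (hinr _).2 fun _ => ht
        · exact univ_mem' fun t => (hinr _).2 fun h => (hxU h).elim
    · rintro (y | y) ⟨hy1, hy2⟩
      · exact hy1
      · exact (hinr y).1 hy2 hy1
  · exact ⟨univ, _, hX, isOpen_univ, hleaf x, ⟨trivial, rfl⟩, by rintro _ ⟨-, rfl⟩; exact hx⟩

namespace IsHADClass

variable {A B : ObjectProperty TopCat.{u}}

lemma fanSpace_mem (hB : IsHADClass A B) {X : TopCat.{u}} (hX : B X) {T : Type u} {F : Filter T}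
    (hF : B (primeSpace F)) (hA : A (fanSpace X F)) : B (fanSpace X F) := by
  let Z : Option X → TopCat.{u} := fun i => i.elim X fun _ => primeSpace F
  let f : ∀ i, Z i → X ⊕ X × T := fun i => match i with
    | none => fun x : X => .inl x
    | some x => fun o : Option T => o.elim (.inl x) fun t => .inr (x, t)
  refine hB.mem_of_final hA Z ?_ f fun U => ?_
  · rintro (_ | x)
    · exact hX
    · exact hF
  · rw [isOpen_fanSpace, Option.forall]
    refine and_congr Iff.rfl (forall_congr' fun x => ?_)
    exact (isOpen_primeSpace (G := F) (U := f (some x) ⁻¹' U)).symm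

/-- The leaves over `s` are isolated in the fan space and, `F` being proper, accumulate at `a`
exactly as `s` does. Collapsing them by `fanProj` in the subspace they form with `a` gives the prime
space. -/
lemma primeSpace_nhds_inf_mem (hB : IsHADClass A B) {X : TopCat.{u}} (hX : B X) {T : Type u}
    {F : Filter T} [F.NeBot] (hF : B (primeSpace F)) (hA : A (fanSpace X F)) {a : X} {s : Set X}
    (hA' : A (primeSpace (𝓝 a ⊓ 𝓟 s))) : B (primeSpace (𝓝 a ⊓ 𝓟 s)) := by
  let D : Set (fanSpace X F) := {z | ∃ y : X × T, y.1 ∈ s ∧ z = (.inr y : X ⊕ X × T)}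
  let a' : fanSpace X F := (.inl a : X ⊕ X × T)
  have hmap : (𝓝[D] a').map (fanProj X F) = 𝓝 a ⊓ 𝓟 s := by
    ext V
    rw [mem_map, mem_nhdsWithin]
    change _ ↔ V ∈ 𝓝[s] a
    rw [mem_nhdsWithin]
    constructor
    · rintro ⟨O, hO, haO, hOV⟩
      have hO' := isOpen_fanSpace.1 hO
      refine ⟨_, hO'.1, haO, ?_⟩
      rintro b ⟨hbO, hbs⟩
      obtain ⟨t, ht⟩ := Filter.nonempty_of_mem (hO'.2 b hbO)
      exact hOV ⟨ht, (b, t), hbs, rfl⟩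
    · rintro ⟨O, hO, haO, hOV⟩
      refine ⟨_, hO.preimage (continuous_fanProj X F), haO, ?_⟩
      rintro _ ⟨hzO, y, hys, rfl⟩
      exact hOV ⟨hzO, hys⟩
  rw [← hmap] at hA' ⊢
  refine hB.primeSpace_map_nhdsWithin_mem (hB.fanSpace_mem hX hF hA) ?_ _ (fun v => ?_) hA'
  · rintro ⟨y, -, hy⟩
    exact Sum.inl_ne_inr hy
  · rw [isOpen_fanSpace]
    refine ⟨?_, ?_⟩
    · convert isOpen_empty using 1
      exact eq_empty_of_forall_notMem fun x ⟨⟨y, _, hy⟩, _⟩ => Sum.inl_ne_inr hy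
    · rintro x ⟨⟨y, -, hy⟩, -⟩
      exact (Sum.inl_ne_inr hy).elim

/-- A non-discrete Hausdorff space has a quotient of a subspace that is a non-discrete Hausdorff
prime space. -/
lemma exists_primeSpace_mem (hA : IsEpireflective A) (hHaus : ∀ X : TopCat.{u}, A X → T2Space X)
    (hB : IsHADClass A B) {X : TopCat.{u}} (hX : B X) (hd : ¬ DiscreteTopology X) :
    ∃ (T : Type u) (F : Filter T), F.NeBot ∧ F.ker = ∅ ∧ B (primeSpace F) := by
  have := hHaus X (hB.le X hX)
  obtain ⟨t, ht⟩ : ∃ t : X, ¬ IsOpen {t} := by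
    by_contra! h
    exact hd (discreteTopology_iff_isOpen_singleton.2 h)
  -- A maximal disjoint family of open sets whose closures miss `t`. Maximality makes `t` adherent
  -- to the union; the condition on closures makes the filter of the collapsed space free.
  obtain ⟨M, hM⟩ := zorn_subset
    {S : Set (Set X) | S.PairwiseDisjoint id ∧ ∀ U ∈ S, IsOpen U ∧ t ∉ closure U} (by
      intro c hc hchain
      refine ⟨⋃₀ c, ⟨?_, ?_⟩, fun s hs => subset_sUnion_of_mem hs⟩
      · exact (pairwiseDisjoint_sUnion hchain.directedOn).2 fun s hs => (hc hs).1
      · rintro U ⟨s, hs, hU⟩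
        exact (hc hs).2 U hU)
  obtain ⟨hdisj, hopen⟩ := hM.prop
  set D : Set X := ⋃₀ M with hD
  have htD : t ∉ D := by
    rintro ⟨U, hU, htU⟩
    exact (hopen U hU).2 (subset_closure htU)
  have hdense : t ∈ closure D := by
    by_contra hcl
    have hne : ¬ (closure D)ᶜ ⊆ {t} := by
      intro h
      have : (closure D)ᶜ = {t} := subset_antisymm h (by rintro _ rfl; exact hcl)
      exact ht (this ▸ isClosed_closure.isOpen_compl)
    obtain ⟨x, hx, hxt⟩ := not_subset.1 hne
    obtain ⟨V, W, hV, hW, hxV, htW, hVW⟩ := t2_separation hxt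
    let U := V ∩ (closure D)ᶜ
    have hUo : IsOpen U := hV.inter isClosed_closure.isOpen_compl
    have hUt : t ∉ closure U := fun h => by
      obtain ⟨y, hyW, hyU⟩ := mem_closure_iff.1 h W hW htW
      exact disjoint_left.1 hVW hyU.1 hyW
    have hins : insert U M ∈ {S : Set (Set X) | S.PairwiseDisjoint id ∧
        ∀ U ∈ S, IsOpen U ∧ t ∉ closure U} := by
      refine ⟨hdisj.insert fun W hW _ => ?_, ?_⟩
      · refine disjoint_left.2 fun y hyU hyW => hyU.2 (subset_closure ⟨W, hW, hyW⟩)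
      · rintro W (rfl | hW)
        · exact ⟨hUo, hUt⟩
        · exact hopen W hW
    have hUM : U ∈ M := hM.le_of_ge hins (subset_insert _ _) (mem_insert _ _)
    exact hx (subset_closure ⟨U, hUM, hxV, hx⟩)
  classical
  -- Each point of `D` is labelled by its member of `M`; the default `∅` is harmless, as the filter
  -- lives on `D`.
  let l : X → Set X := fun x => if h : ∃ U ∈ M, x ∈ U then h.choose else ∅
  have hl (x : X) (U : Set X) (hU : U ∈ M) (hx : x ∈ U) : l x = U := by
    have h : ∃ U ∈ M, x ∈ U := ⟨U, hU, hx⟩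
    rw [show l x = h.choose from dif_pos h]
    by_contra hne
    exact disjoint_left.1 (hdisj h.choose_spec.1 hU hne) h.choose_spec.2 hx
  have hker : ((𝓝[D] t).map l).ker = ∅ := by
    rw [ker_eq_empty_iff_compl_singleton_mem]
    intro V
    rw [mem_map, mem_nhdsWithin]
    -- The second set is empty or everything; it covers the values `V` that are not labels.
    refine ⟨(closure V)ᶜ ∪ {x | V ∉ M}, ?_, ?_, ?_⟩
    · exact isClosed_closure.isOpen_compl.union isOpen_const
    · by_cases hV : V ∈ M
      · exact Or.inl (hopen V hV).2
      · exact Or.inr hV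
    · rintro x ⟨hx, U, hU, hxU⟩ hxV
      obtain rfl : U = V := (hl x U hU hxU).symm.trans hxV
      rcases hx with hx | hx
      · exact hx (subset_closure hxU)
      · exact hx hU
  refine ⟨Set X, (𝓝[D] t).map l, ?_, hker, ?_⟩
  · have := mem_closure_iff_nhdsWithin_neBot.1 hdense
    infer_instance
  · refine hB.primeSpace_map_nhdsWithin_mem hX htD l (fun V => ?_) (hA.primeSpace_mem hHaus hker)
    by_cases hV : V ∈ M
    · convert (hopen V hV).1 using 1
      ext x
      constructor
      · rintro ⟨⟨U, hU, hxU⟩, hx⟩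
        obtain rfl : U = V := (hl x U hU hxU).symm.trans hx
        exact hxU
      · exact fun hx => ⟨⟨V, hV, hx⟩, hl x V hV hx⟩
    · convert isOpen_empty using 1
      refine eq_empty_of_forall_notMem ?_
      rintro x ⟨⟨U, hU, hxU⟩, hx⟩
      obtain rfl : U = V := (hl x U hU hxU).symm.trans hx
      exact hV hU

/-- If `X` is not discrete, it supplies by itself the free filter needed to build its fan space. -/
lemma primeSpace_nhdsNE_mem (hA : IsEpireflective A) (hHaus : ∀ X : TopCat.{u}, A X → T2Space X)
    (hB : IsHADClass A B) {X : TopCat.{u}} (hX : B X) (a : X) : B (primeSpace (𝓝[≠] a)) := by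
  have := hHaus X (hB.le X hX)
  by_cases hd : DiscreteTopology X
  · have := discreteTopology_primeSpace_bot (α := X)
    rw [discreteTopology_iff_nhds_ne.1 hd a]
    exact hB.discrete_mem _
  · obtain ⟨T, F, hne, hker, hF⟩ := hB.exists_primeSpace_mem hA hHaus hX hd
    refine hB.primeSpace_nhds_inf_mem hX hF (hA.fanSpace_mem hHaus (hB.le X hX) hker)
      (hA.primeSpace_mem hHaus ?_)
    rw [ker_eq_empty_iff_compl_singleton_mem]
    intro x
    by_cases hx : x = a
    · subst hx
      exact self_mem_nhdsWithin
    · exact mem_nhdsWithin_of_mem_nhds (isOpen_compl_singleton.mem_nhds (Ne.symm hx))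

end IsHADClass

/-! ### Filters whose free part has its prime space in `B` -/

lemma ker_inf_principal_eq_empty {α : Type u} {F : Filter α} {s : Set α} (hs : s ⊆ F.kerᶜ) :
    (F ⊓ 𝓟 s).ker = ∅ := by
  rw [ker_eq_empty_iff_compl_singleton_mem]
  intro t
  rw [mem_inf_principal]
  by_cases ht : t ∈ F.ker
  · exact univ_mem' fun x hx hxt => hs hx ((show x = t from hxt) ▸ ht)
  · simp only [mem_ker, not_forall] at ht
    obtain ⟨V, hV, htV⟩ := ht
    filter_upwards [hV] with x hx _ hxt
    exact htV ((show x = t from hxt) ▸ hx)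

/-- The prime space of the free part of `F` belongs to `B`. -/
def HasPrimeIn (B : ObjectProperty TopCat.{u}) {α : Type u} (F : Filter α) : Prop :=
  B (primeSpace (F ⊓ 𝓟 F.kerᶜ))

/-- The spaces all of whose neighbourhood filters have the prime spaces of their free parts
in `B`. -/
def primeClass (B : ObjectProperty TopCat.{u}) : ObjectProperty TopCat.{u} :=
  fun X => ∀ a : X, HasPrimeIn B (𝓝 a)

section HasPrimeIn

variable {A B : ObjectProperty TopCat.{u}}

lemma HasPrimeIn.primeSpace_inf_mem (hA : IsEpireflective A)
    (hHaus : ∀ X : TopCat.{u}, A X → T2Space X) (hB : IsHADClass A B)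
    {α : Type u} {F : Filter α} (hF : HasPrimeIn B F) {s : Set α}
    (hs : s ⊆ F.kerᶜ) : B (primeSpace (F ⊓ 𝓟 s)) := by
  have h : F ⊓ 𝓟 s = F ⊓ 𝓟 F.kerᶜ ⊓ 𝓟 s := by
    rw [inf_assoc, inf_principal, inter_eq_self_of_subset_right hs]
  have hA' := hA.primeSpace_mem hHaus (ker_inf_principal_eq_empty hs)
  rw [h] at hA' ⊢
  exact hB.primeSpace_inf_principal_mem s hA' hF

/-- Since `g` carries `F.ker` into `(F.map g).ker`, the free part of the image is the image of a
restriction of the free part of `F`. -/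
lemma HasPrimeIn.map (hA : IsEpireflective A)
    (hHaus : ∀ X : TopCat.{u}, A X → T2Space X) (hB : IsHADClass A B)
    {α β : Type u} {F : Filter α} (hF : HasPrimeIn B F) (g : α → β) :
    HasPrimeIn B (F.map g) := by
  unfold HasPrimeIn
  have hA' := hA.primeSpace_mem hHaus (ker_inf_principal_eq_empty (subset_refl (F.map g).kerᶜ))
  rw [← map_inf_principal_preimage] at hA' ⊢
  refine hB.primeSpace_map_mem g hA' (hF.primeSpace_inf_mem hA hHaus hB ?_)
  intro x hx hxF
  exact hx (mem_ker.2 fun s hs => mem_ker.1 hxF _ hs)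

/-- Outside the kernel of the supremum every member of `S` is free. -/
lemma HasPrimeIn.of_sSup (hA : IsEpireflective A)
    (hHaus : ∀ X : TopCat.{u}, A X → T2Space X) (hB : IsHADClass A B)
    {α : Type u} {S : Set (Filter α)} (hS : ∀ F ∈ S, HasPrimeIn B F) :
    HasPrimeIn B (sSup S) := by
  unfold HasPrimeIn
  have h : sSup S ⊓ 𝓟 (sSup S).kerᶜ = sSup ((fun F => F ⊓ 𝓟 (sSup S).kerᶜ) '' S) := by
    rw [sSup_image]
    simp only [iSup_inf_principal, ← sSup_eq_iSup]
  have hA' := hA.primeSpace_mem hHaus (ker_inf_principal_eq_empty (subset_refl (sSup S).kerᶜ))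
  rw [h] at hA' ⊢
  refine hB.primeSpace_sSup_mem hA' ?_
  rintro _ ⟨F, hF, rfl⟩
  exact (hS F hF).primeSpace_inf_mem hA hHaus hB
    (compl_subset_compl.2 (ker_mono (le_sSup hF)))

lemma HasPrimeIn.restrict (hA : IsEpireflective A)
    (hHaus : ∀ X : TopCat.{u}, A X → T2Space X) (hB : IsHADClass A B)
    {α : Type u} {F : Filter α} (hF : HasPrimeIn B F) (s : Set α) :
    HasPrimeIn B (F ⊓ 𝓟 s) := by
  unfold HasPrimeIn
  have h : F ⊓ 𝓟 s ⊓ 𝓟 (F ⊓ 𝓟 s).kerᶜ = F ⊓ 𝓟 (s \ F.ker) := by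
    rw [inf_assoc, inf_principal]
    congr 2
    ext x
    simp only [ker_inf, ker_principal, mem_inter_iff, mem_compl_iff, Set.mem_sdiff]
    tauto
  rw [h]
  exact hF.primeSpace_inf_mem hA hHaus hB fun x hx => hx.2

lemma hasPrimeIn_principal (hB : IsHADClass A B) {α : Type u} (s : Set α) : HasPrimeIn B (𝓟 s) := by
  unfold HasPrimeIn
  have := discreteTopology_primeSpace_bot (α := α)
  rw [ker_principal, inf_principal, inter_compl_self, principal_empty]
  exact hB.discrete_mem _

end HasPrimeIn

/-! ### The tree space of a filter system -/

/-- The space of finite words in `E`, where the words `e :: w` converge to `w` along `K w`. -/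
abbrev treeSpace {E : Type u} (K : List E → Filter E) : TopCat.{u} :=
  filterSpace fun w => (K w).map (· :: w)

lemma isOpen_treeSpace {E : Type u} {K : List E → Filter E} {U : Set (treeSpace K)} :
    IsOpen U ↔ ∀ w : List E, w ∈ U → {e | (e :: w : List E) ∈ U} ∈ K w := Iff.rfl

/-- The words reachable from `w` without leaving `U`. -/
inductive TreeReachable {E : Type u} (U : Set (List E)) (w : List E) : List E → Prop
  | refl : TreeReachable U w w
  | cons (v : List E) (e : E) : TreeReachable U w v → e :: v ∈ U → TreeReachable U w (e :: v)

lemma IsEpireflective.treeSpace_mem {A : ObjectProperty TopCat.{u}} (hA : IsEpireflective A)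
    (hHaus : ∀ X : TopCat.{u}, A X → T2Space X) {E : Type u} {K : List E → Filter E}
    (hK : ∀ w, (K w).ker = ∅) : A (treeSpace K) := by
  have hfree := fun w => compl_singleton_mem_of_ker_eq_empty (hK w)
  have hne (v w : List E) : {e | e :: w ≠ v} ∈ K w := by
    rcases v with _ | ⟨e, v⟩
    · exact univ_mem' fun e => List.cons_ne_nil e w
    · filter_upwards [hfree w e] with e' he' h
      exact he' (List.cons.inj h).1
  have : T1Space (treeSpace K) := by
    refine ⟨fun v => ?_⟩
    rw [← isOpen_compl_iff, isOpen_treeSpace]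
    exact fun w _ => hne v w
  refine hA.mem_of_clopen hHaus _ fun w U hU hw => ?_
  -- `R` is open because reachable words extend inside `U` along almost all letters. It is closed
  -- because a word outside `R` has at most `w` itself as a one-letter extension in `R`, and
  -- freeness excludes that letter.
  let R : Set (treeSpace K) := {v | TreeReachable (E := E) U w v}
  have hRU : R ⊆ U := by
    rintro _ (_ | ⟨v, e, -, h⟩)
    · exact hw
    · exact h
  refine ⟨R, ⟨?_, ?_⟩, TreeReachable.refl, hRU⟩
  · rw [← isOpen_compl_iff, isOpen_treeSpace]
    intro v hv
    filter_upwards [hne w v] with e he h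
    generalize hx : e :: v = x at h he
    cases h with
    | refl => exact he rfl
    | cons v' e' h' _ =>
      obtain ⟨-, rfl⟩ := List.cons.inj hx
      exact hv h'
  · rw [isOpen_treeSpace]
    intro v hv
    filter_upwards [isOpen_treeSpace.1 hU v (hRU hv)] with e he
    exact TreeReachable.cons v e hv he

lemma IsHADClass.treeSpace_mem {A B : ObjectProperty TopCat.{u}} (hB : IsHADClass A B)
    (hA : IsEpireflective A) (hHaus : ∀ X : TopCat.{u}, A X → T2Space X) {E : Type u}
    {K : List E → Filter E} (hK : ∀ w, (K w).ker = ∅) (hKB : ∀ w, B (primeSpace (K w))) :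
    B (treeSpace K) := by
  refine hB.mem_of_primeSpace (hA.treeSpace_mem hHaus hK)
    (fun w : List E => (K w).map (· :: w)) (fun w : List E => ?_) fun U => Iff.rfl
  refine hB.primeSpace_map_mem (β := List E) _ (hA.primeSpace_mem hHaus ?_) (hKB w)
  rw [ker_eq_empty_iff_compl_singleton_mem]
  rintro (_ | ⟨e, v⟩)
  · exact mem_map.2 (univ_mem' fun e => List.cons_ne_nil e w)
  · rw [mem_map]
    filter_upwards [compl_singleton_mem_of_ker_eq_empty (hK w) e] with e' he' h
    exact he' (List.cons.inj h).1

/-- If `B` contains a non-discrete prime space, then every filter with prime space in `B` is the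
image of a free one. -/
lemma HasPrimeIn.exists_free_lift {A B : ObjectProperty TopCat.{u}} (hA : IsEpireflective A)
    (hHaus : ∀ X : TopCat.{u}, A X → T2Space X) (hB : IsHADClass A B) {T : Type u} {F : Filter T}
    [F.NeBot] (hFker : F.ker = ∅) (hF : B (primeSpace F)) {α : Type u} {G : Filter α}
    (hG : HasPrimeIn B G) :
    ∃ K : Filter (α × T), K.map Prod.fst = G ∧ K.ker = ∅ ∧ B (primeSpace K) := by
  obtain ⟨t₀⟩ : Nonempty T := F.nonempty_of_neBot
  -- The free part of `G` is lifted to height `t₀`; each kernel point `b` is spread along `{b} × T`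
  -- by a copy of `F`.
  let G₀ : Filter (α × T) := (G ⊓ 𝓟 G.kerᶜ).map fun a => (a, t₀)
  let S : Set (Filter (α × T)) := insert G₀ ((fun b => F.map (Prod.mk b)) '' G.ker)
  have hSker : ∀ K ∈ S, K.ker = ∅ := by
    simp only [ker_eq_empty_iff_compl_singleton_mem]
    rintro _ (rfl | ⟨b, -, rfl⟩) ⟨a, t⟩
    · rw [mem_map]
      filter_upwards [compl_singleton_mem_of_ker_eq_empty
        (ker_inf_principal_eq_empty (subset_refl G.kerᶜ)) a] with x hx h
      exact hx (congrArg Prod.fst h)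
    · rw [mem_map]
      filter_upwards [compl_singleton_mem_of_ker_eq_empty hFker t] with x hx h
      exact hx (congrArg Prod.snd h)
  have hker : (sSup S).ker = ∅ := by
    rw [ker_sSup]
    simpa using hSker
  have hSB : ∀ K ∈ S, B (primeSpace K) := by
    intro K hK
    have hAK := hA.primeSpace_mem hHaus (hSker K hK)
    rcases hK with rfl | ⟨b, -, rfl⟩
    · exact hB.primeSpace_map_mem _ hAK hG
    · exact hB.primeSpace_map_mem _ hAK hF
  refine ⟨sSup S, ?_, hker, hB.primeSpace_sSup_mem (hA.primeSpace_mem hHaus hker) hSB⟩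
  ext V
  rw [mem_map, mem_sSup]
  constructor
  · intro h
    have h0 := h G₀ (mem_insert _ _)
    rw [mem_map, mem_inf_principal] at h0
    filter_upwards [h0] with a ha
    by_cases hak : a ∈ G.ker
    · have h1 := h _ (mem_insert_of_mem _ ⟨a, hak, rfl⟩)
      obtain ⟨t, ht⟩ := Filter.nonempty_of_mem (mem_map.1 h1)
      exact ht
    · exact ha hak
  · rintro hV _ (rfl | ⟨b, hb, rfl⟩)
    · exact mem_map.2 (mem_inf_of_left hV)
    · exact mem_map.2 (univ_mem' fun _ => mem_ker.1 hb V hV)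

/-! ### The class of spaces with prime factors in `B` -/

lemma sSup_inf_compl_ker_principal_ker {α : Type u} (F : Filter α) :
    sSup {F ⊓ 𝓟 F.kerᶜ, 𝓟 F.ker} = F := by
  rw [sSup_pair]
  refine le_antisymm (sup_le inf_le_left fun s hs => fun x hx => mem_ker.1 hx s hs) ?_
  intro s hs
  obtain ⟨h1, h2⟩ := mem_sup.1 hs
  rw [mem_inf_principal] at h1
  filter_upwards [h1] with x hx
  by_cases hxk : x ∈ F.ker
  · exact h2 hxk
  · exact hx hxk

section PrimeClass

variable {A B : ObjectProperty TopCat.{u}}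

lemma IsHADClass.finitelyGenerated_le_primeClass (hB : IsHADClass A B) :
    FinitelyGeneratedSpaces ≤ primeClass B := by
  intro X hX a
  have : AlexandrovDiscrete X := hX
  rw [← principal_nhdsKer_singleton]
  exact hasPrimeIn_principal hB _

lemma isHereditaryClass_primeClass (hA : IsEpireflective A)
    (hHaus : ∀ X : TopCat.{u}, A X → T2Space X) (hB : IsHADClass A B) :
    IsHereditaryClass (primeClass B) := by
  classical
  intro X hX s a
  change HasPrimeIn B (@nhds s _ a)
  let g : X → s := fun x => if h : x ∈ s then ⟨x, h⟩ else a
  have hg : g ∘ Subtype.val = id := funext fun x => dif_pos x.2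
  have h : @nhds s _ a = (𝓝 a.1 ⊓ 𝓟 s).map g := by
    have h1 := map_comap (𝓝 a.1) (Subtype.val : s → X)
    rw [Subtype.range_coe] at h1
    rw [← h1, map_map, hg, map_id, nhds_subtype]
  rw [h]
  exact ((hX a.1).restrict hA hHaus hB s).map hA hHaus hB g

/-- The neighbourhood filter of `a` may be strictly coarser than `H a`, as neighbourhoods iterate
the filters. The tree unfolds this iteration, using free lifts so as to stay in `A`; its label map
is continuous and open, so `𝓝 a` is the image of the neighbourhood filter of the root. -/
lemma primeClass_filterSpace (hA : IsEpireflective A)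
    (hHaus : ∀ X : TopCat.{u}, A X → T2Space X) (hB : IsHADClass A B) {Y : Type u}
    {H : Y → Filter Y} (hH : ∀ y, HasPrimeIn B (H y)) : primeClass B (filterSpace H) := by
  by_cases hT : ∃ (T : Type u) (F : Filter T), F.NeBot ∧ F.ker = ∅ ∧ B (primeSpace F)
  · obtain ⟨T, F, hne, hker, hF⟩ := hT
    choose K hKH hKker hKB using fun y => (hH y).exists_free_lift hA hHaus hB hker hF
    intro a
    let label : List (Y × T) → Y := fun w => w.head?.elim a Prod.fst
    let W : TopCat.{u} := treeSpace fun w => K (label w)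
    let f : W → filterSpace H := label
    have hmem (V : Set Y) (w : List (Y × T)) :
        V ∈ H (label w) ↔ {e : Y × T | e.1 ∈ V} ∈ K (label w) := by
      rw [← hKH (label w), mem_map]
      rfl
    have hcont : Continuous f := by
      refine continuous_def.2 fun U hU => isOpen_treeSpace.2 fun w hw => ?_
      exact (hmem U w).1 (hU _ hw)
    have hopen : IsOpenMap f := by
      rintro G hG _ ⟨w, hw, rfl⟩
      refine (hmem _ w).2 ?_
      filter_upwards [isOpen_treeSpace.1 hG w hw] with e he
      exact ⟨_, he, rfl⟩
    have hWB : B W := hB.treeSpace_mem hA hHaus (fun w => hKker _) fun w => hKB _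
    let root : W := ([] : List (Y × T))
    have hroot : HasPrimeIn B (𝓝 root) := by
      have := hHaus W (hB.le W hWB)
      unfold HasPrimeIn
      rw [ker_nhds]
      exact hB.primeSpace_nhdsNE_mem hA hHaus hWB root
    have hmap : (𝓝 root).map f = 𝓝 a := hopen.map_nhds_eq hcont.continuousAt
    rw [← hmap]
    exact hroot.map hA hHaus hB f
  -- Without nontrivial free filters all `H y` are principal, and the space is finitely generated.
  · have hbot (y : Y) : H y = 𝓟 (H y).ker := by
      have h : H y ⊓ 𝓟 (H y).kerᶜ = ⊥ := by
        by_contra hne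
        exact hT ⟨Y, _, ⟨hne⟩, ker_inf_principal_eq_empty subset_rfl, hH y⟩
      conv_lhs => rw [← sSup_inf_compl_ker_principal_ker (H y), h]
      simp
    refine hB.finitelyGenerated_le_primeClass _ ⟨fun S hS => ?_⟩
    intro y hy
    rw [hbot y]
    refine mem_principal.2 (subset_sInter fun s hs => ?_)
    have h := hS s hs y (hy s hs)
    rw [hbot y] at h
    exact mem_principal.1 h

lemma isCoreflective_primeClass (hA : IsEpireflective A)
    (hHaus : ∀ X : TopCat.{u}, A X → T2Space X) (hB : IsHADClass A B) :
    IsCoreflective (primeClass B) where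
  isSubcategory :=
    { isoClosed := ⟨fun {X Y} e hX a => by
        let h := TopCat.homeoOfIso e
        have := (hX (h.symm a)).map hA hHaus hB h
        rwa [h.map_nhds_eq, h.apply_symm_apply] at this⟩
      exists_nontrivial := by
        have : DiscreteTopology (primeSpace (⊥ : Filter PUnit.{u + 1})) :=
          discreteTopology_primeSpace_bot
        refine ⟨primeSpace (⊥ : Filter PUnit.{u + 1}), hB.finitelyGenerated_le_primeClass _ ?_,
          none, some PUnit.unit, (Option.some_ne_none PUnit.unit).symm⟩
        change AlexandrovDiscrete (primeSpace (⊥ : Filter PUnit.{u + 1}))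
        infer_instance }
  exists_coreflection X := by
    -- The largest admissible filter below `𝓝 x`; it bounds the image of `𝓝 p` under any continuous
    -- map from a member of the class that sends `p` to `x`.
    let H : X → Filter X := fun x => sSup {F | HasPrimeIn B F ∧ F ≤ 𝓝 x}
    have hH (x : X) : HasPrimeIn B (H x) := .of_sSup hA hHaus hB fun F hF => hF.1
    have hle (x : X) : H x ≤ 𝓝 x := sSup_le fun F hF => hF.2
    let c : filterSpace H → X := id
    have hc : Continuous c := continuous_def.2 fun U hU x hx => hle x (hU.mem_nhds hx)
    refine ⟨filterSpace H, TopCat.ofHom (X := filterSpace H) ⟨c, hc⟩,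
      primeClass_filterSpace hA hHaus hB hH, fun P hP f => ?_⟩
    let f' : P → filterSpace H := fun p => f p
    have hf : Continuous f' := by
      refine continuous_def.2 fun U hU => isOpen_iff_mem_nhds.2 fun p hp => ?_
      have h1 : (𝓝 p).map f ≤ H (f p) :=
        le_sSup ⟨(hP p).map hA hHaus hB f, f.hom.continuous.continuousAt⟩
      exact h1 (hU _ hp)
    refine ⟨TopCat.ofHom (Y := filterSpace H) ⟨f', hf⟩, rfl, ?_⟩
    rintro g rfl
    rfl

lemma primeClass_inf_eq (hA : IsEpireflective A)
    (hHaus : ∀ X : TopCat.{u}, A X → T2Space X) (hB : IsHADClass A B) :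
    primeClass B ⊓ A = B := by
  refine le_antisymm ?_ fun X hX => ⟨fun a => ?_, hB.le X hX⟩
  · rintro X ⟨hX, hXA⟩
    have := hHaus X hXA
    refine hB.mem_of_primeSpace hXA (fun a => 𝓝 a ⊓ 𝓟 (𝓝 a).kerᶜ) hX fun U => ?_
    rw [isOpen_iff_mem_nhds]
    refine forall₂_congr fun a ha => ?_
    conv_lhs => rw [← sSup_inf_compl_ker_principal_ker (𝓝 a), sSup_pair, mem_sup]
    -- In a Hausdorff space the kernel of `𝓝 a` is `{a}`, so the principal part only says `a ∈ U`.
    refine and_iff_left ?_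
    simpa [ker_nhds] using ha
  · have := hHaus X (hB.le X hX)
    unfold HasPrimeIn
    rw [ker_nhds]
    exact hB.primeSpace_nhdsNE_mem hA hHaus hX a

/-- A hereditary coreflective subcategory containing the finitely generated spaces is determined
by its members in `A`. -/
lemma IsCoreflective.eq_primeClass_inf (hA : IsEpireflective A)
    (hHaus : ∀ X : TopCat.{u}, A X → T2Space X) {C : ObjectProperty TopCat.{u}}
    (hC : IsCoreflective C) (hh : IsHereditaryClass C) (hFG : FinitelyGeneratedSpaces ≤ C) :
    C = primeClass (C ⊓ A) := by
  have hC' := hC.isHADClass_top hh hFG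
  have hprincipal {α : Type u} (s : Set α) : C (primeSpace (𝓟 s)) := by
    refine hFG _ ⟨fun S hS => ?_⟩
    rw [isOpen_primeSpace]
    intro hn
    rw [mem_principal]
    intro a ha
    refine mem_sInter.2 fun U hU => ?_
    exact mem_principal.1 (isOpen_primeSpace.1 (hS U hU) (hn U hU)) ha
  refine le_antisymm ?_ fun X hX => ?_
  · intro X hX a
    refine ⟨?_, hA.primeSpace_mem hHaus (ker_inf_principal_eq_empty subset_rfl)⟩
    -- With `Top` as ambient category the fan filter need not be free, so the principal filter on a
    -- point serves, its prime space being finitely generated.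
    have : (𝓟 (univ : Set PUnit.{u + 1})).NeBot := by
      rw [principal_univ]; infer_instance
    exact hC'.primeSpace_nhds_inf_mem hX (hprincipal (univ : Set PUnit.{u + 1})) trivial trivial
  · refine hC'.mem_of_primeSpace trivial (fun a => 𝓝 a) (fun a => ?_) fun U => isOpen_iff_mem_nhds
    rw [← sSup_inf_compl_ker_principal_ker (𝓝 a)]
    refine hC'.primeSpace_sSup_mem trivial ?_
    rintro _ (rfl | rfl)
    · exact (hX a).1
    · exact hprincipal _

end PrimeClass

theorem mainTheorem6 (A : ObjectProperty TopCat.{u}) (hA : IsEpireflective A)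
    (hHaus : ∀ X : TopCat.{u}, A X → T2Space X) :
    Set.BijOn (fun C : ObjectProperty TopCat.{u} => C ⊓ A)
      {C | IsCoreflective C ∧ IsHereditaryClass C ∧ FinitelyGeneratedSpaces ≤ C}
      {B | IsHADClass A B} := by
  refine ⟨?_, ?_, ?_⟩
  · rintro C ⟨hC, hh, hFG⟩
    exact hC.isHADClass_inf hh hFG hA hHaus
  · rintro C₁ ⟨hC₁, hh₁, hFG₁⟩ C₂ ⟨hC₂, hh₂, hFG₂⟩ (h : C₁ ⊓ A = C₂ ⊓ A)
    rw [hC₁.eq_primeClass_inf hA hHaus hh₁ hFG₁, hC₂.eq_primeClass_inf hA hHaus hh₂ hFG₂, h]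
  · intro B hB
    exact ⟨primeClass B, ⟨isCoreflective_primeClass hA hHaus hB,
      isHereditaryClass_primeClass hA hHaus hB, IsHADClass.finitelyGenerated_le_primeClass hB⟩,
      primeClass_inf_eq hA hHaus hB⟩
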